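/- Fix a constant $0<\varepsilon\le 1/100$. For every $n$ let $p=p(n)\in[0,1]$ and let $\mathcal P=\mathcal P(n)$ be a monotone increasing graph property, that is, a family of graphs on the vertex set $[n]$ that is closed under adding edges. Suppose that $\mathcal P$ is $(p,\varepsilon)$-resilient: with probability tending to $1$ as $n\to\infty$, the binomial random graph $G\sim\mathbb G(n,p)$ has the property that $G\setminus R\in\mathcal P$ for every subgraph $R\subseteq G$ with $d_R(v)\le\varepsilon\, d_G(v)$ for all vertices $v$. Then for all sufficiently large $n$ the following holds: if $\frac{10\ln n}{\varepsilon n}\le p<1$, then for every integer $0\le b\le\frac{\varepsilon}{60p}$ (in particular for $b=\lfloor \varepsilon/(60p)\rfloor$) Walker has a strategy in the $(2:b)$ Walker--Breaker game on $K_n$ to create a graph that satisfies $\mathcal P$. Here the $(2:b)$ Walker--Breaker game on $K_n$ is played on the edge set of $K_n$ in rounds, each consisting of a move of Breaker followed by a move of Walker. In his move Breaker claims $b$ edges not yet claimed by either player (all remaining ones if fewer than $b$ are left). In her move Walker walks along two edges, one after the other, starting from her current vertex (in her first move, from a vertex of her choice); she may use any edge not claimed by Breaker, including edges that she has already claimed,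 and she claims the edges that she uses. That Walker has a strategy to create a graph satisfying $\mathcal P$ means that there is a (deterministic) strategy with which, however Breaker plays, she can always move and the graph on $[n]$ formed by all edges she has claimed eventually satisfies $\mathcal P$. -/

import Mathlib

open Filter Topology

namespace WalkerBreaker

/-- A position of the Walker-Breaker game on the edge set of the complete graph on `V`:
the graph of Walker's edges, the graph of Breaker's edges, and Walker's current vertex
(`none` as long as Walker has not made her first move). -/
structure Position (V : Type) where
  walker : SimpleGraph V
  breaker : SimpleGraph V
  location : Option V

variable {V : Type}

/-- At the beginning no edge is claimed and Walker has not chosen a starting vertex. -/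
def Position.initial : Position V := ⟨⊥, ⊥, none⟩

/-- The graph of free edges: the edges of the complete graph claimed by neither player. -/
def Position.free (s : Position V) : SimpleGraph V := (s.walker ⊔ s.breaker)ᶜ

/-- With bias `b`, Breaker has to claim exactly `b` free edges, or all the free edges if there are
fewer than `b` of them. The graph `F` consists of the edges claimed in this move. -/
def Position.BreakerLegal (b : ℕ) (s : Position V) (F : SimpleGraph V) : Prop :=
  F ≤ s.free ∧ F.edgeSet.ncard = min b s.free.edgeSet.ncard

/-- The position after Breaker has claimed the edges of `F`. -/
def Position.afterBreaker (s : Position V) (F : SimpleGraph V) : Position V :=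
  { s with breaker := s.breaker ⊔ F }

/-- A move of Walker with bias `2` is a walk `start, mid, last` with two steps. -/
structure WalkerMove (V : Type) where
  start : V
  mid : V
  last : V

/-- Walker starts from her current vertex (from any vertex in her first move), and walks twice along
an edge that is not claimed by Breaker; the edge may already be her own. -/
def Position.WalkerLegal (s : Position V) (m : WalkerMove V) : Prop :=
  (∀ v, s.location = some v → m.start = v) ∧
    s.breakerᶜ.Adj m.start m.mid ∧ s.breakerᶜ.Adj m.mid m.last

/-- The position after Walker has made the move `m`: she owns both edges that she has used. -/
def Position.afterWalker (s : Position V) (m : WalkerMove V) : Position V where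
  walker := s.walker ⊔ SimpleGraph.edge m.start m.mid ⊔ SimpleGraph.edge m.mid m.last
  breaker := s.breaker
  location := some m.last

/-- A (deterministic) strategy of Walker: her next move as a function of the list of all moves that
Breaker has made so far. Her own earlier moves are determined by that list and the strategy. -/
abbrev Strategy (V : Type) : Type := List (SimpleGraph V) → WalkerMove V

/-- Walker's reply in round `k` (rounds are numbered from `0`) to Breaker's moves `F 0, …, F k`. -/
def reply (σ : Strategy V) (F : ℕ → SimpleGraph V) (k : ℕ) : WalkerMove V :=
  σ ((List.range (k + 1)).map F)

/-- The position after `k` rounds, when Walker follows `σ` and Breaker plays `F 0, F 1, …`.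
In each round Breaker moves first. -/
def play (σ : Strategy V) (F : ℕ → SimpleGraph V) : ℕ → Position V
  | 0 => Position.initial
  | k + 1 => ((play σ F k).afterBreaker (F k)).afterWalker (reply σ F k)

/-- Walker has a strategy in the `(2 : b)` Walker-Breaker game on the complete graph on `V` to create
a graph in `P`: however Breaker plays, all the moves of the strategy are legal, and after some
round the graph of Walker's edges is in `P`. Once all edges are claimed, further rounds change
neither player's graph, so nothing is lost by letting the play run on. -/
def WalkerCanCreate (b : ℕ) (P : Set (SimpleGraph V)) : Prop :=
  ∃ σ : Strategy V, ∀ F : ℕ → SimpleGraph V,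
    (∀ k, (play σ F k).BreakerLegal b (F k)) →
      (∀ k, ((play σ F k).afterBreaker (F k)).WalkerLegal (reply σ F k)) ∧
        ∃ k, (play σ F k).walker ∈ P

/-- The graph `G` satisfies `P` robustly: deleting any subgraph `R` that contains at each vertex at
most an `ε`-fraction of the edges of `G` leaves a graph in `P`. -/
def RobustlyIn (P : Set (SimpleGraph V)) (ε : ℝ) (G : SimpleGraph V) : Prop :=
  ∀ R : SimpleGraph V, R ≤ G →
    (∀ v, ((R.neighborSet v).ncard : ℝ) ≤ ε * ((G.neighborSet v).ncard : ℝ)) → G \ R ∈ P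

/-- `(p, ε)`-resilience of the property `P = P(n)`: asymptotically almost surely the random graph
`G(n, p(n))` satisfies `P(n)` robustly. -/
def IsResilient (P : ∀ n : ℕ, Set (SimpleGraph (Fin n))) (p : ℕ → unitInterval) (ε : ℝ) : Prop :=
  Tendsto (fun n : ℕ => SimpleGraph.binomialRandom (Fin n) (p n)
    {G : SimpleGraph (Fin n) | RobustlyIn (P n) ε G}) atTop (𝓝 1)

end WalkerBreaker

namespace WalkerBreaker

open MeasureTheory
-- Walker generates a binomial random graph online and derandomizes it by conditional probabilities.
-- At any time the pairs in `E` are exposed and those in `A ≤ E` are declared present. Let `S` be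
-- the event that the graph is robustly in the property and all its degrees lie between np/2 and
-- 3np/2. Walker keeps the conditional probability of `S` given `cylinder A E` above 1/2: by
-- averaging, one of the two outcomes of each new pair preserves this (`half_lt_split`). Hence some
-- graph of `S` contains `A`, so degrees in `A` never exceed 3np/2.
--
-- Breaker only does harm by claiming pairs before they are exposed. If in the end at most εn/7
-- pairs at each vertex are unexposed, an exponential moment bound yields a graph of `S` in the
-- cylinder whose unexposed part has degrees at most εnp/2. Robustness allows deleting this part,
-- and what remains is exactly `A` (`mem_of_half_lt`).
--
-- To keep Breaker's degrees small, Walker uses the potential given by `weight`, summed over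
-- vertices that still have a pair to expose. In one round she walks to such a vertex of largest
-- weight; in the next she exposes there until one pair is present or none is left. This takes away
-- at least 1/21 of that weight, while the two Breaker moves add at most 2.1/50 of it, so the
-- potential stays at most n. Bounded degrees in `A` then bound Breaker's degrees
-- (`walkerCanCreate_of_online`).
/-- The degree of `v` in `G`. -/
noncomputable def deg {V : Type} (G : SimpleGraph V) (v : V) : ℕ := (G.neighborSet v).ncard

/-! ### Degrees and edge counts -/

section Degrees

theorem deg_sup_le {V : Type} (G H : SimpleGraph V) (v : V) :
    deg (G ⊔ H) v ≤ deg G v + deg H v := by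
  have : (G ⊔ H).neighborSet v = G.neighborSet v ∪ H.neighborSet v := by ext; simp
  unfold deg
  rw [this]
  exact Set.ncard_union_le _ _

variable {V : Type} [Fintype V]

theorem deg_mono {G H : SimpleGraph V} (h : G ≤ H) (v : V) : deg G v ≤ deg H v :=
  Set.ncard_le_ncard (fun _ hw => h hw) (Set.toFinite _)

theorem deg_top (v : V) : deg (⊤ : SimpleGraph V) v = Fintype.card V - 1 := by
  classical
  have h : deg (⊤ : SimpleGraph V) v = (⊤ : SimpleGraph V).degree v := by
    rw [deg, Set.ncard_eq_toFinset_card', ← SimpleGraph.card_neighborFinset_eq_degree]; rfl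
  rw [h, SimpleGraph.complete_graph_degree]

theorem sum_deg (G : SimpleGraph V) : ∑ v, deg G v = 2 * G.edgeSet.ncard := by
  classical
  have h : ∀ v, deg G v = G.degree v := fun v => by
    rw [deg, Set.ncard_eq_toFinset_card', ← SimpleGraph.card_neighborFinset_eq_degree]; rfl
  simp_rw [h]
  rw [G.sum_degrees_eq_twice_card_edges, Set.ncard_eq_toFinset_card']
  rfl

theorem deg_le_ncard_edgeSet (G : SimpleGraph V) (v : V) : deg G v ≤ G.edgeSet.ncard := by
  refine Set.ncard_le_ncard_of_injOn (fun w => s(v, w)) (fun w hw => hw) ?_ (Set.toFinite _)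
  exact fun a _ b _ hab => Sym2.congr_right.1 hab

end Degrees

instance {V : Type} [Fintype V] : DiscreteMeasurableSpace (SimpleGraph V) := by
  have : MeasurableSingletonClass (SimpleGraph V) := ⟨fun G => by
    have h : ({G} : Set (SimpleGraph V)) = SimpleGraph.edgeSet ⁻¹' {G.edgeSet} := by
      ext H; simp
    rw [h]
    exact SimpleGraph.measurable_edgeSet (MeasurableSet.singleton _)⟩
  infer_instance

/-! ### Exponential moments of degrees, conditionally on exposed edges -/

section Moments

/-- The graphs that agree with `A` on the edges of `E`. -/
def cylinder {V : Type} (A E : SimpleGraph V) : Set (SimpleGraph V) := {G | G ⊓ E = A}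

open scoped Classical in
-- A condition on each edge separately, so that the indicator of a cylinder factors over the edges.
theorem mem_cylinder_iff {V : Type} {A E G : SimpleGraph V} (h : A ≤ E) :
    G ∈ cylinder A E ↔ ∀ e : Sym2 V, ¬ e.IsDiag →
      if e ∈ G.edgeSet then ¬ (e ∈ E.edgeSet ∧ e ∉ A.edgeSet) else e ∉ A.edgeSet := by
  have hE : A.edgeSet ⊆ E.edgeSet := SimpleGraph.edgeSet_subset_edgeSet.2 h
  unfold cylinder
  rw [Set.mem_ofPred_eq, ← SimpleGraph.edgeSet_inj, SimpleGraph.edgeSet_inf, Set.ext_iff]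
  refine forall_congr' fun e => ?_
  have h1 : e ∈ G.edgeSet → ¬ e.IsDiag := G.not_isDiag_of_mem_edgeSet
  have h2 : e ∈ E.edgeSet → ¬ e.IsDiag := E.not_isDiag_of_mem_edgeSet
  have h3 := @hE e
  simp only [Set.mem_inter_iff]
  by_cases a : e ∈ G.edgeSet <;> by_cases b : e ∈ E.edgeSet <;> by_cases c : e ∈ A.edgeSet <;>
    simp_all

variable {V : Type} [Fintype V]

open scoped Classical in
-- Expanding the product chooses `a` or `b` at each non-diagonal pair, and such choices are exactly
-- the graphs.
theorem sum_prod_edges (a b : Sym2 V → ℝ) :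
    ∑ G : SimpleGraph V, ∏ e : Sym2 V with ¬ e.IsDiag, (if e ∈ G.edgeSet then a e else b e)
      = ∏ e : Sym2 V with ¬ e.IsDiag, (a e + b e) := by
  rw [Finset.prod_add]
  refine Finset.sum_bij' (fun G _ => G.edgeFinset) (fun T _ => SimpleGraph.fromEdgeSet T)
    ?_ ?_ ?_ ?_ ?_
  · intro G _
    simp only [Finset.mem_powerset]
    intro e he
    simpa using G.not_isDiag_of_mem_edgeSet (by simpa using he)
  · intros; simp
  · intros; simp
  · intro T hT
    ext e
    simp only [Finset.mem_powerset] at hT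
    simp only [SimpleGraph.mem_edgeFinset, SimpleGraph.edgeSet_fromEdgeSet, Set.mem_sdiff,
      Finset.mem_coe]
    refine ⟨fun h => h.1, fun h => ⟨h, ?_⟩⟩
    simpa using hT h
  · intro G _
    have hsub : G.edgeFinset ⊆ Finset.univ.filter (fun e : Sym2 V => ¬ e.IsDiag) := by
      intro e he
      simpa using G.not_isDiag_of_mem_edgeSet (by simpa using he)
    rw [← Finset.prod_sdiff hsub, mul_comm]
    congr 1
    · exact Finset.prod_congr rfl fun e he => by rw [if_pos (by simpa using he)]
    · exact Finset.prod_congr rfl fun e he => by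
        rw [if_neg (by simpa using (Finset.mem_sdiff.1 he).2)]

open scoped Classical in
theorem binomialRandom_real_singleton (p : unitInterval) (G : SimpleGraph V) :
    (SimpleGraph.binomialRandom V p).real {G}
      = ∏ e : Sym2 V with ¬ e.IsDiag, (if e ∈ G.edgeSet then (p : ℝ) else 1 - p) := by
  rw [measureReal_def, SimpleGraph.binomialRandom_singleton, Finset.prod_ite,
    Finset.prod_const, Finset.prod_const]
  have h1 : (Finset.univ.filter (fun e : Sym2 V => ¬ e.IsDiag)).filter (fun e => e ∈ G.edgeSet)
      = G.edgeFinset := by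
    ext e
    simp only [Finset.mem_filter, Finset.mem_univ, true_and, SimpleGraph.mem_edgeFinset]
    exact ⟨fun h => h.2, fun h => ⟨G.not_isDiag_of_mem_edgeSet h, h⟩⟩
  have h2 : G.edgeSet.ncard = G.edgeFinset.card := by
    rw [Set.ncard_eq_toFinset_card']; rfl
  have h3 : (Finset.univ.filter (fun e : Sym2 V => ¬ e.IsDiag)).card
      = (Nat.card V).choose 2 := by
    rw [Nat.card_eq_fintype_card, ← Sym2.card_subtype_not_diag, Fintype.card_subtype]
  have h4 := Finset.card_filter_add_card_filter_not
    (s := Finset.univ.filter (fun e : Sym2 V => ¬ e.IsDiag)) (fun e => e ∈ G.edgeSet)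
  rw [h1, h3] at h4
  rw [h1, h2, show (Nat.card V).choose 2 - G.edgeFinset.card = _ from by
    rw [← h4, Nat.add_sub_cancel_left]]
  simp

open scoped Classical in
theorem binomialRandom_real_eq_sum (p : unitInterval) (S : Set (SimpleGraph V)) :
    (SimpleGraph.binomialRandom V p).real S
      = ∑ G : SimpleGraph V, if G ∈ S then (SimpleGraph.binomialRandom V p).real {G} else 0 := by
  rw [← Finset.sum_filter, sum_measureReal_singleton]
  simp

open scoped Classical in
theorem pow_deg_eq_prod (G X : SimpleGraph V) (v : V) (z : ℝ) :
    z ^ deg (G ⊓ X) v = ∏ e : Sym2 V with ¬ e.IsDiag,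
      (if e ∈ G.edgeSet then (if e ∈ X.edgeSet ∧ v ∈ e then z else 1) else 1) := by
  have h : ∀ e : Sym2 V, (if e ∈ G.edgeSet then (if e ∈ X.edgeSet ∧ v ∈ e then z else 1) else 1)
      = if e ∈ (G ⊓ X).edgeSet ∧ v ∈ e then z else 1 := by
    intro e
    by_cases a : e ∈ G.edgeSet <;> simp [a]
  simp_rw [h]
  rw [Finset.prod_ite, Finset.prod_const, Finset.prod_const_one, mul_one]
  congr 1
  rw [deg, Set.ncard_eq_toFinset_card _ (Set.toFinite _)]
  refine Finset.card_bij (fun w _ => s(v, w)) ?_ ?_ ?_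
  · intro w hw
    have hw' : (G ⊓ X).Adj v w := (Set.Finite.mem_toFinset _).1 hw
    simp only [Finset.mem_filter, Finset.mem_univ, true_and]
    exact ⟨by simpa using hw'.ne, hw', by simp⟩
  · exact fun a _ b _ hab => Sym2.congr_right.1 hab
  · intro e he
    simp only [Finset.mem_filter, Finset.mem_univ, true_and] at he
    obtain ⟨-, he, w, rfl⟩ := he
    exact ⟨w, (Set.Finite.mem_toFinset _).2 he, rfl⟩

open scoped Classical in
-- By independence everything is a product over edges. Since `X` avoids `E`, each edge of `X` at `v`
-- is unconstrained and contributes `1 - p + p * z`.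
theorem sum_cylinder_pow_deg (p : unitInterval) {A E X : SimpleGraph V} (hAE : A ≤ E)
    (hX : Disjoint X E) (v : V) (z : ℝ) :
    ∑ G : SimpleGraph V, (if G ∈ cylinder A E then
        (SimpleGraph.binomialRandom V p).real {G} * z ^ deg (G ⊓ X) v else 0)
      = (1 - p + p * z) ^ deg X v * (SimpleGraph.binomialRandom V p).real (cylinder A E) := by
  have key : ∀ z : ℝ, ∑ G : SimpleGraph V, (if G ∈ cylinder A E then
        (SimpleGraph.binomialRandom V p).real {G} * z ^ deg (G ⊓ X) v else 0)
      = ∏ e : Sym2 V with ¬ e.IsDiag,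
        ((if e ∈ E.edgeSet ∧ e ∉ A.edgeSet then 0 else
          (p : ℝ) * (if e ∈ X.edgeSet ∧ v ∈ e then z else 1)) +
          (if e ∈ A.edgeSet then 0 else 1 - (p : ℝ))) := by
    intro z
    rw [← sum_prod_edges]
    refine Finset.sum_congr rfl fun G _ => ?_
    by_cases hG : G ∈ cylinder A E
    · rw [if_pos hG, binomialRandom_real_singleton, pow_deg_eq_prod, ← Finset.prod_mul_distrib]
      refine Finset.prod_congr rfl fun e he => ?_
      have := (mem_cylinder_iff hAE).1 hG e (by simpa using he)
      by_cases a : e ∈ G.edgeSet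
      · rw [if_pos a] at this; simp only [a, if_true]; rw [if_neg this]
      · rw [if_neg a] at this; simp only [a, if_false]; rw [if_neg this, mul_one]
    · rw [if_neg hG]
      rw [mem_cylinder_iff hAE] at hG
      rw [not_forall] at hG
      obtain ⟨e, hG⟩ := hG
      rw [Classical.not_imp] at hG
      obtain ⟨he, hG⟩ := hG
      symm
      refine Finset.prod_eq_zero (i := e) (by simpa using he) ?_
      by_cases a : e ∈ G.edgeSet
      · rw [if_pos a]
        rw [if_pos a, not_not] at hG
        rw [if_pos hG]
      · rw [if_neg a]
        rw [if_neg a, not_not] at hG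
        rw [if_pos hG]
  rw [key z]
  -- At `z = 1` the formula computes the probability of the cylinder itself.
  have h1 := key 1
  simp only [one_pow, mul_one, ite_self] at h1
  rw [binomialRandom_real_eq_sum, h1]
  have h2 := pow_deg_eq_prod (⊤ : SimpleGraph V) X v (1 - p + p * z)
  rw [top_inf_eq] at h2
  rw [h2, ← Finset.prod_mul_distrib]
  refine Finset.prod_congr rfl fun e he => ?_
  have hdiag : ¬ e.IsDiag := by simpa using he
  have heT : e ∈ (⊤ : SimpleGraph V).edgeSet := by simpa using hdiag
  rw [if_pos heT]
  by_cases hx : e ∈ X.edgeSet ∧ v ∈ e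
  · have hE : e ∉ E.edgeSet := fun h =>
      Set.disjoint_left.1 (SimpleGraph.disjoint_edgeSet.2 hX) hx.1 h
    have hA : e ∉ A.edgeSet := fun h => hE (SimpleGraph.edgeSet_subset_edgeSet.2 hAE h)
    simp only [hE, hA, if_pos hx, false_and, if_false]
    ring
  · simp only [if_neg hx, one_mul, mul_one]

/-- Exponential Markov inequality for the degree of `v` in the random graph inside `X`,
conditionally on the edges outside of `X`. -/
theorem cylinder_tail (p : unitInterval) {A E X : SimpleGraph V} (hAE : A ≤ E)
    (hX : Disjoint X E) (v : V) {z : ℝ} (hz : 0 < z) (S : Set (SimpleGraph V)) (s : ℝ)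
    (hS : ∀ G ∈ S, Real.exp s ≤ z ^ deg (G ⊓ X) v) :
    (SimpleGraph.binomialRandom V p).real (cylinder A E ∩ S)
      ≤ Real.exp (p * (z - 1) * deg X v - s)
        * (SimpleGraph.binomialRandom V p).real (cylinder A E) := by
  classical
  have h0 := p.2.1
  have h1 : Real.exp s * (SimpleGraph.binomialRandom V p).real (cylinder A E ∩ S)
      ≤ (1 - p + p * z) ^ deg X v * (SimpleGraph.binomialRandom V p).real (cylinder A E) := by
    rw [← sum_cylinder_pow_deg p hAE hX v z, binomialRandom_real_eq_sum, Finset.mul_sum]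
    refine Finset.sum_le_sum fun G _ => ?_
    by_cases hG : G ∈ cylinder A E
    · by_cases hG' : G ∈ S
      · rw [if_pos ⟨hG, hG'⟩, if_pos hG, mul_comm]
        exact mul_le_mul_of_nonneg_left (hS G hG') measureReal_nonneg
      · rw [if_neg (fun h => hG' h.2), if_pos hG, mul_zero]
        positivity
    · rw [if_neg (fun h => hG h.1), if_neg hG, mul_zero]
  have h2 : (1 - (p : ℝ) + p * z) ^ deg X v ≤ Real.exp (p * (z - 1) * deg X v) := by
    rw [mul_comm (_ * _), Real.exp_nat_mul]
    refine pow_le_pow_left₀ ?_ ?_ _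
    · have := p.2.2
      have := mul_nonneg h0 hz.le
      linarith
    · have := Real.add_one_le_exp ((p : ℝ) * (z - 1))
      linarith
  rw [Real.exp_sub, div_mul_eq_mul_div, le_div_iff₀ (Real.exp_pos _), mul_comm _ (Real.exp s)]
  exact h1.trans (mul_le_mul_of_nonneg_right h2 measureReal_nonneg)

end Moments

/-! ### Strategies from invariants, and legality of moves -/

section Strategies

variable {V : Type}

/-- The position and the number of rounds after the history `l` of Breaker's moves, when Walker
chooses her moves by `f` from the round number, the position and Breaker's last move. -/
def replay (f : ℕ → Position V → SimpleGraph V → WalkerMove V) (l : List (SimpleGraph V)) :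
    ℕ × Position V :=
  l.foldl (fun q F => (q.1 + 1, (q.2.afterBreaker F).afterWalker (f q.1 q.2 F)))
    (0, Position.initial)

/-- A strategy sees only Breaker's moves, but replaying them recovers the position, so a choice of
move depending on round, position and Breaker's last move suffices. -/
theorem walkerCanCreate_of_invariant [Nonempty V] {b : ℕ} {P : Set (SimpleGraph V)}
    (Inv : ℕ → Position V → Prop) (h0 : Inv 0 Position.initial)
    (hstep : ∀ r s F, Inv r s → s.BreakerLegal b F →
      ∃ m, (s.afterBreaker F).WalkerLegal m ∧ Inv (r + 1) ((s.afterBreaker F).afterWalker m))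
    (hend : ∃ r, ∀ s, Inv r s → s.walker ∈ P) : WalkerCanCreate b P := by
  classical
  obtain ⟨x⟩ := ‹Nonempty V›
  have hf : ∀ r s F, ∃ m : WalkerMove V, Inv r s → s.BreakerLegal b F →
      (s.afterBreaker F).WalkerLegal m ∧ Inv (r + 1) ((s.afterBreaker F).afterWalker m) := by
    intro r s F
    by_cases h : Inv r s ∧ s.BreakerLegal b F
    · obtain ⟨m, hm⟩ := hstep r s F h.1 h.2
      exact ⟨m, fun _ _ => hm⟩
    · exact ⟨⟨x, x, x⟩, fun h1 h2 => absurd ⟨h1, h2⟩ h⟩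
  choose f hf using hf
  -- The last entry is the move to be answered, hence `dropLast`; the default `⊥` is never used,
  -- because the history passed by `reply` is nonempty.
  let σ : Strategy V := fun l =>
    f (replay f l.dropLast).1 (replay f l.dropLast).2 (l.getLast?.getD ⊥)
  refine ⟨σ, fun F hF => ?_⟩
  have hrep : ∀ k, replay f ((List.range k).map F) = (k, play σ F k) ∧
      reply σ F k = f k (play σ F k) (F k) := by
    intro k
    induction k with
    | zero =>
      refine ⟨rfl, ?_⟩
      simp [reply, σ, replay, play]
    | succ k ih =>
      have h1 : replay f ((List.range (k + 1)).map F) = (k + 1, play σ F (k + 1)) := by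
        have : replay f ((List.range (k + 1)).map F)
            = ((replay f ((List.range k).map F)).1 + 1,
              ((replay f ((List.range k).map F)).2.afterBreaker (F k)).afterWalker
                (f (replay f ((List.range k).map F)).1 (replay f ((List.range k).map F)).2 (F k)))
            := by
          unfold replay
          rw [List.range_succ, List.map_append, List.foldl_append]
          rfl
        rw [this, ih.1]
        simp only [play, ih.2]
      refine ⟨h1, ?_⟩
      have h2 : reply σ F (k + 1) = σ ((List.range (k + 1)).map F ++ [F (k + 1)]) := by
        unfold reply
        rw [List.range_succ (n := k + 1), List.map_append]
        rfl
      rw [h2]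
      simp only [σ, List.dropLast_concat, List.getLast?_concat, Option.getD_some, h1]
  have hinv : ∀ k, Inv k (play σ F k) := by
    intro k
    induction k with
    | zero => exact h0
    | succ k ih =>
      have := (hf k _ (F k) ih (hF k)).2
      rw [← (hrep k).2] at this
      exact this
  refine ⟨fun k => ?_, ?_⟩
  · rw [(hrep k).2]
    exact (hf k _ (F k) (hinv k) (hF k)).1
  · obtain ⟨r, hr⟩ := hend
    exact ⟨r, hr _ (hinv r)⟩

theorem Position.WalkerLegal.disjoint {s : Position V} {m : WalkerMove V} (hm : s.WalkerLegal m)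
    (hs : Disjoint s.walker s.breaker) :
    Disjoint (s.afterWalker m).walker (s.afterWalker m).breaker := by
  have h : ∀ v w, s.breakerᶜ.Adj v w → Disjoint (SimpleGraph.edge v w) s.breaker := by
    intro v w hvw
    rw [← le_compl_iff_disjoint_right]
    exact (SimpleGraph.edge_le_iff _).2 (Or.inr hvw)
  simp only [Position.afterWalker, disjoint_sup_left]
  exact ⟨⟨hs, h _ _ hm.2.1⟩, h _ _ hm.2.2⟩

theorem Position.WalkerLegal.adj_last {s : Position V} {m : WalkerMove V} (hm : s.WalkerLegal m) :
    (s.afterWalker m).walker.Adj m.last m.mid := by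
  simp only [Position.afterWalker, SimpleGraph.sup_adj]
  exact Or.inr ((SimpleGraph.edge_adj _ _ _ _).2 ⟨Or.inr ⟨rfl, rfl⟩, hm.2.2.ne'⟩)

theorem Position.walker_le_afterWalker (s : Position V) (m : WalkerMove V) :
    s.walker ≤ (s.afterWalker m).walker := by
  simp only [Position.afterWalker, sup_assoc]
  exact le_sup_left

theorem Position.edge_le_afterWalker (s : Position V) (m : WalkerMove V) :
    SimpleGraph.edge m.start m.mid ≤ (s.afterWalker m).walker :=
  le_sup_right.trans le_sup_left

/-- Walking along one of her own edges and back is a legal move of Walker. -/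
theorem Position.walkerLegal_back {s : Position V} {x u : V} (hl : s.location = some x)
    (hu : s.walker.Adj x u) (hd : Disjoint s.walker s.breaker) : s.WalkerLegal ⟨x, u, x⟩ := by
  have h : s.breakerᶜ.Adj x u := (le_compl_iff_disjoint_right.2 hd) hu
  refine ⟨fun v hv => ?_, h, h.symm⟩
  rw [hl] at hv
  exact Option.some.inj hv

theorem Position.BreakerLegal.disjoint_walker {b : ℕ} {s : Position V} {F : SimpleGraph V}
    (h : s.BreakerLegal b F) : Disjoint s.walker F :=
  (le_compl_iff_disjoint_left.1 h.1).mono_left le_sup_left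

theorem Position.BreakerLegal.disjoint_breaker {b : ℕ} {s : Position V} {F : SimpleGraph V}
    (h : s.BreakerLegal b F) : Disjoint s.breaker F :=
  (le_compl_iff_disjoint_left.1 h.1).mono_left le_sup_right

theorem Position.BreakerLegal.disjoint {b : ℕ} {s : Position V} {F : SimpleGraph V}
    (h : s.BreakerLegal b F) (hs : Disjoint s.walker s.breaker) :
    Disjoint (s.afterBreaker F).walker (s.afterBreaker F).breaker := by
  simp only [Position.afterBreaker, disjoint_sup_right]
  exact ⟨hs, h.disjoint_walker⟩

theorem Position.BreakerLegal.ncard_le {b : ℕ} {s : Position V} {F : SimpleGraph V}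
    (h : s.BreakerLegal b F) : F.edgeSet.ncard ≤ b :=
  h.2.le.trans (min_le_left _ _)

end Strategies

/-! ### Exposure of edges and the potential function -/

section Combinatorics

variable {V : Type} [Fintype V]

theorem deg_sup_of_disjoint {G H : SimpleGraph V} (h : Disjoint G H) (v : V) :
    deg (G ⊔ H) v = deg G v + deg H v := by
  have : (G ⊔ H).neighborSet v = G.neighborSet v ∪ H.neighborSet v := by ext; simp
  unfold deg
  rw [this]
  refine Set.ncard_union_eq ?_ (Set.toFinite _) (Set.toFinite _)
  rw [Set.disjoint_left]
  intro w hG hH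
  exact (SimpleGraph.disjoint_left.1 h) _ _ hG hH

theorem exists_two_step_path (B : SimpleGraph V) (x v : V)
    (h : deg B x + deg B v + 2 < Fintype.card V) :
    ∃ u, Bᶜ.Adj x u ∧ Bᶜ.Adj u v := by
  by_contra hcon
  push Not at hcon
  have hsub : (Set.univ : Set V) ⊆ (B.neighborSet x ∪ B.neighborSet v) ∪ {x, v} := by
    intro u _
    by_contra hu
    simp only [Set.mem_union, SimpleGraph.mem_neighborSet, Set.mem_insert_iff,
      Set.mem_singleton_iff, not_or] at hu
    exact hcon u ((SimpleGraph.compl_adj _ _ _).2 ⟨Ne.symm hu.2.1, hu.1.1⟩)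
      ((SimpleGraph.compl_adj _ _ _).2 ⟨hu.2.2, fun h => hu.1.2 h.symm⟩)
  have h1 := Set.ncard_le_ncard hsub (Set.toFinite _)
  have h2 := Set.ncard_union_le (B.neighborSet x ∪ B.neighborSet v) {x, v}
  have h3 := Set.ncard_union_le (B.neighborSet x) (B.neighborSet v)
  have h4 : ({x, v} : Set V).ncard ≤ 2 := (Set.ncard_insert_le x {v}).trans (by simp)
  rw [Set.ncard_univ, Nat.card_eq_fintype_card] at h1
  unfold deg at h
  omega

/-- Walker exposes, one after the other, the edges at `v` that are not claimed by Breaker and not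
yet exposed, until a first one turns out to be in her random graph. The predicate `Q A E` says that
the outcome `A` on the set `E` of exposed edges is acceptable. -/
theorem exists_exposure {Q : SimpleGraph V → SimpleGraph V → Prop}
    (hsplit : ∀ A E v w, v ≠ w → ¬ E.Adj v w → A ≤ E → Q A E →
      Q A (E ⊔ SimpleGraph.edge v w) ∨ Q (A ⊔ SimpleGraph.edge v w) (E ⊔ SimpleGraph.edge v w))
    (B : SimpleGraph V) (v : V) {A E : SimpleGraph V} (hAE : A ≤ E) (hQ : Q A E) :
    ∃ A' E', A' ≤ E' ∧ E ≤ E' ∧ Q A' E' ∧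
      ((A' = A ∧ ∀ w, ¬ (E' ⊔ B)ᶜ.Adj v w) ∨
        ∃ w, (E ⊔ B)ᶜ.Adj v w ∧ E'.Adj v w ∧ A' = A ⊔ SimpleGraph.edge v w) := by
  induction hk : deg (E ⊔ B)ᶜ v using Nat.strong_induction_on generalizing E with
  | _ k ih =>
    by_cases hw : ∃ w, (E ⊔ B)ᶜ.Adj v w
    · obtain ⟨w, hw⟩ := hw
      have hw' := hw
      rw [SimpleGraph.compl_adj, SimpleGraph.sup_adj, not_or] at hw'
      have hadj : (E ⊔ SimpleGraph.edge v w).Adj v w :=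
        Or.inr ((SimpleGraph.edge_adj _ _ _ _).2 ⟨Or.inl ⟨rfl, rfl⟩, hw'.1⟩)
      rcases hsplit A E v w hw'.1 hw'.2.1 hAE hQ with hQ' | hQ'
      · have hlt : deg ((E ⊔ SimpleGraph.edge v w) ⊔ B)ᶜ v < k := by
          rw [← hk]
          refine Set.ncard_lt_ncard ?_ (Set.toFinite _)
          refine (Set.ssubset_iff_of_subset ?_).2 ⟨w, hw, ?_⟩
          · intro y hy
            exact compl_le_compl (sup_le_sup_right le_sup_left B) hy
          · intro h
            exact ((SimpleGraph.compl_adj _ _ _).1 h).2 (Or.inl hadj)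
        obtain ⟨A', E', h1, h2, h3, h4⟩ := ih _ hlt (hAE.trans le_sup_left) hQ' rfl
        refine ⟨A', E', h1, le_sup_left.trans h2, h3, ?_⟩
        rcases h4 with h4 | ⟨y, hy1, hy2, hy3⟩
        · exact Or.inl h4
        · exact Or.inr ⟨y, compl_le_compl (sup_le_sup_right le_sup_left B) hy1, hy2, hy3⟩
      · exact ⟨_, _, sup_le_sup_right hAE _, le_sup_left, hQ', Or.inr ⟨w, hw, hadj, rfl⟩⟩
    · push Not at hw
      exact ⟨A, E, hAE, le_rfl, hQ, Or.inl ⟨rfl, hw⟩⟩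

/-- The weight of `v` in the potential function. -/
noncomputable def weight (β : ℝ) (A B : SimpleGraph V) (v : V) : ℝ :=
  Real.exp (deg B v / (100 * β) - deg A v / 20)

open scoped Classical in
/-- The vertices with an edge that is neither in `E` (exposed) nor in `B` (claimed by Breaker). -/
noncomputable def active (E B : SimpleGraph V) : Finset V := {v | ∃ w, (E ⊔ B)ᶜ.Adj v w}

theorem mem_active {E B : SimpleGraph V} {v : V} : v ∈ active E B ↔ ∃ w, (E ⊔ B)ᶜ.Adj v w := by
  simp [active]

theorem active_anti {E E' B B' : SimpleGraph V} (hE : E ≤ E') (hB : B ≤ B') :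
    active E' B' ⊆ active E B := by
  intro v hv
  rw [mem_active] at hv ⊢
  obtain ⟨w, hw⟩ := hv
  exact ⟨w, compl_le_compl (sup_le_sup hE hB) hw⟩

theorem weight_pos {V : Type} (β : ℝ) (A B : SimpleGraph V) (v : V) : 0 < weight β A B v := Real.exp_pos _

theorem weight_anti {β : ℝ} {A A' : SimpleGraph V} (h : A ≤ A') (B : SimpleGraph V) (v : V) :
    weight β A' B v ≤ weight β A B v := by
  refine Real.exp_le_exp.2 (sub_le_sub_left ?_ _)
  have : (deg A v : ℝ) ≤ deg A' v := by exact_mod_cast deg_mono h v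
  linarith

theorem weight_mono {β : ℝ} (hβ : 0 < β) (A : SimpleGraph V) {B B' : SimpleGraph V} (h : B ≤ B')
    (v : V) : weight β A B v ≤ weight β A B' v := by
  refine Real.exp_le_exp.2 (sub_le_sub_right ?_ _)
  have : (deg B v : ℝ) ≤ deg B' v := by exact_mod_cast deg_mono h v
  gcongr

theorem weight_sup {β : ℝ} (A : SimpleGraph V) {B F : SimpleGraph V} (h : Disjoint B F) (v : V) :
    weight β A (B ⊔ F) v = weight β A B v * Real.exp (deg F v / (100 * β)) := by
  rw [weight, weight, ← Real.exp_add, deg_sup_of_disjoint h]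
  congr 1
  push_cast
  ring

/-- One move of Breaker increases the potential only slightly. -/
theorem sum_weight_sup_le {β : ℝ} (hβ : 0 < β) (A : SimpleGraph V) {B F : SimpleGraph V}
    (h : Disjoint B F) (hF : (F.edgeSet.ncard : ℝ) ≤ β) (S : Finset V) {M : ℝ} (hM : 0 ≤ M)
    (hS : ∀ v ∈ S, weight β A (B ⊔ F) v ≤ M) :
    ∑ v ∈ S, weight β A (B ⊔ F) v ≤ ∑ v ∈ S, weight β A B v + M / 50 := by
  have h1 : ∀ v ∈ S, weight β A (B ⊔ F) v
      ≤ weight β A B v + deg F v / (100 * β) * M := by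
    intro v hv
    set t : ℝ := deg F v / (100 * β) with ht
    have ht0 : 0 ≤ t := by positivity
    have h2 : weight β A (B ⊔ F) v * (1 - t) ≤ weight β A B v := by
      rw [weight_sup A h, mul_assoc]
      -- Thus the increase at `v` is at most `t` times the new weight, hence at most `t * M`; the
      -- values `t` sum to at most 1/50 by the handshake lemma.
      have : Real.exp t * (1 - t) ≤ 1 := by
        have h3 : 1 - t ≤ Real.exp (-t) := by
          have := Real.add_one_le_exp (-t); linarith
        calc Real.exp t * (1 - t) ≤ Real.exp t * Real.exp (-t) :=
              mul_le_mul_of_nonneg_left h3 (Real.exp_pos _).le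
          _ = 1 := by rw [← Real.exp_add]; simp
      calc _ ≤ weight β A B v * 1 := mul_le_mul_of_nonneg_left this (weight_pos _ _ _ _).le
        _ = _ := mul_one _
    have h4 := mul_le_mul_of_nonneg_left (hS v hv) ht0
    linarith
  have h2 : ∑ v ∈ S, (deg F v : ℝ) ≤ 2 * β := by
    calc ∑ v ∈ S, (deg F v : ℝ) ≤ ∑ v, (deg F v : ℝ) :=
          Finset.sum_le_sum_of_subset_of_nonneg (Finset.subset_univ _) fun _ _ _ => by positivity
      _ = 2 * (F.edgeSet.ncard : ℝ) := by exact_mod_cast sum_deg F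
      _ ≤ 2 * β := by linarith
  refine (Finset.sum_le_sum h1).trans ?_
  rw [Finset.sum_add_distrib, ← Finset.sum_mul, ← Finset.sum_div]
  have h3 : (∑ v ∈ S, (deg F v : ℝ)) / (100 * β) ≤ 1 / 50 := by
    rw [div_le_iff₀ (by positivity)]
    linarith
  have := mul_le_mul_of_nonneg_right h3 hM
  linarith

end Combinatorics

/-! ### Walker's two-round cycle -/

section Game

variable {V : Type} [Fintype V]

/-- At an inactive vertex every unexposed pair is already Breaker's, so the harm done there is
frozen. -/
theorem deg_sdiff_le_of_not_mem_active {E E' B F : SimpleGraph V} (hE : E ≤ E') {v : V}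
    (hv : v ∉ active E B) : deg ((B ⊔ F) \ E') v ≤ deg (B \ E) v := by
  refine Set.ncard_le_ncard (fun w hw => ?_) (Set.toFinite _)
  rw [mem_active] at hv
  push Not at hv
  have h := hv w
  rw [SimpleGraph.mem_neighborSet, SimpleGraph.sdiff_adj] at hw ⊢
  have h1 : ¬ E.Adj v w := fun h => hw.2 (hE h)
  rw [SimpleGraph.compl_adj, SimpleGraph.sup_adj] at h
  have := hw.1.ne
  tauto

theorem deg_le_of_weight_le {V : Type} {β d : ℝ} (hβ : 0 < β) {A B : SimpleGraph V} {v : V} {M : ℝ}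
    (hM : weight β A B v ≤ M) (hd : (deg A v : ℝ) ≤ d) :
    (deg B v : ℝ) ≤ 100 * β * Real.log M + 5 * β * d := by
  have h := (Real.le_log_iff_exp_le ((weight_pos β A B v).trans_le hM)).2 hM
  have h1 : (deg B v : ℝ) / (100 * β) ≤ Real.log M + d / 20 := by linarith
  rw [div_le_iff₀ (by positivity)] at h1
  linarith

theorem weight_sup_edge_le {β : ℝ} {A E : SimpleGraph V} (hAE : A ≤ E) (B : SimpleGraph V)
    {v w : V} (hvw : v ≠ w) (hE : ¬ E.Adj v w) :
    weight β (A ⊔ SimpleGraph.edge v w) B v ≤ 20 / 21 * weight β A B v := by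
  have hdis : Disjoint A (SimpleGraph.edge v w) := by
    rw [SimpleGraph.disjoint_edge]
    exact fun h => hE (hAE h)
  have h1 : 1 ≤ deg (SimpleGraph.edge v w) v := by
    unfold deg
    rw [Nat.one_le_iff_ne_zero, ← Nat.pos_iff_ne_zero, Set.ncard_pos (Set.toFinite _)]
    exact ⟨w, (SimpleGraph.edge_adj _ _ _ _).2 ⟨Or.inl ⟨rfl, rfl⟩, hvw⟩⟩
  have h2 : (deg A v : ℝ) + 1 ≤ deg (A ⊔ SimpleGraph.edge v w) v := by
    rw [deg_sup_of_disjoint hdis]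
    push_cast
    have : (1 : ℝ) ≤ deg (SimpleGraph.edge v w) v := by exact_mod_cast h1
    linarith
  have h3 : Real.exp (-(1 / 20) : ℝ) ≤ 20 / 21 := by
    have := Real.add_one_le_exp (1 / 20 : ℝ)
    rw [Real.exp_neg, inv_le_comm₀ (Real.exp_pos _) (by norm_num)]
    linarith
  calc weight β (A ⊔ SimpleGraph.edge v w) B v
      ≤ Real.exp (-(1 / 20) + (deg B v / (100 * β) - deg A v / 20)) := by
        refine Real.exp_le_exp.2 ?_
        linarith
    _ = Real.exp (-(1 / 20)) * weight β A B v := by rw [Real.exp_add]; rfl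
    _ ≤ _ := mul_le_mul_of_nonneg_right h3 (weight_pos _ _ _ _).le

/-- Walker already owns a graph in `P` and can walk back and forth along one of her edges. -/
def Won {V : Type} (P : Set (SimpleGraph V)) (s : Position V) : Prop :=
  s.walker ∈ P ∧ Disjoint s.walker s.breaker ∧ ∃ x u, s.location = some x ∧ s.walker.Adj x u

/-- The invariant before the two rounds in which Walker first walks to a vertex and then exposes
edges there. Here `A` is the graph of the exposed edges that are in the random graph, `E` the graph
of all exposed edges, and `K` bounds the number of edges that can still be exposed. -/
def BeforeApproach (Q : SimpleGraph V → SimpleGraph V → Prop) (β D : ℝ) (K : ℕ)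
    (s : Position V) : Prop :=
  ∃ A E, A ≤ E ∧ A ≤ s.walker ∧ Q A E ∧ Disjoint s.walker s.breaker ∧
    ∑ v ∈ active E s.breaker, weight β A s.breaker v ≤ Fintype.card V ∧
    (∀ v, (deg (s.breaker \ E) v : ℝ) ≤ D) ∧
    (E ⊔ s.breaker)ᶜ.edgeSet.ncard ≤ K ∧
    ((s.location = none ∧ E = ⊥ ∧ s.breaker = ⊥) ∨
      ∃ x u, s.location = some x ∧ s.walker.Adj x u ∧ (deg s.breaker x : ℝ) ≤ D)

/-- The invariant when Walker has walked to the vertex `v` of largest weight, at which she is going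
to expose edges in the next round. -/
def BeforeExposure (Q : SimpleGraph V → SimpleGraph V → Prop) (β D : ℝ) (K : ℕ)
    (s : Position V) : Prop :=
  ∃ A E v u, A ≤ E ∧ A ≤ s.walker ∧ Q A E ∧ Disjoint s.walker s.breaker ∧
    s.location = some v ∧ s.walker.Adj v u ∧ v ∈ active E s.breaker ∧
    (∀ x ∈ active E s.breaker, weight β A s.breaker x ≤ weight β A s.breaker v) ∧
    ∑ x ∈ active E s.breaker, weight β A s.breaker x
      ≤ Fintype.card V + weight β A s.breaker v / 50 ∧
    (∀ x ∈ active E s.breaker, (deg s.breaker x : ℝ) + β ≤ D) ∧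
    (∀ x, (deg (s.breaker \ E) x : ℝ) ≤ D) ∧
    (E ⊔ s.breaker)ᶜ.edgeSet.ncard ≤ K

/-- Legal moves are required forever, so Walker needs a way to continue after success. -/
theorem Won.step {V : Type} {P : Set (SimpleGraph V)} (hP : IsUpperSet P) {b : ℕ} {s : Position V}
    (hs : Won P s) {F : SimpleGraph V} (hF : s.BreakerLegal b F) :
    ∃ m, (s.afterBreaker F).WalkerLegal m ∧ Won P ((s.afterBreaker F).afterWalker m) := by
  obtain ⟨hW, hd, x, u, hl, hxu⟩ := hs
  have hd' := hF.disjoint hd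
  have hm : (s.afterBreaker F).WalkerLegal ⟨x, u, x⟩ := Position.walkerLegal_back hl hxu hd'
  exact ⟨_, hm, hP (Position.walker_le_afterWalker (s.afterBreaker F) _) hW, hm.disjoint hd', x, u,
    rfl, hm.adj_last⟩

variable {Q : SimpleGraph V → SimpleGraph V → Prop} {P : Set (SimpleGraph V)} {b : ℕ} {β d D : ℝ}

theorem BeforeApproach.step (hP : IsUpperSet P) (hβ : 0 < β) (hb : (b : ℝ) ≤ β)
    (hdeg : ∀ A E, Q A E → ∀ v, (deg A v : ℝ) ≤ d)
    (hwin : ∀ A E, A ≤ E → Q A E → (∀ v, (deg Eᶜ v : ℝ) ≤ D + β) → A ∈ P)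
    (hD : 100 * β * Real.log (Fintype.card V) + 5 * β * d + 2 * β ≤ D)
    (hDV : 2 * (D + β) + 2 < Fintype.card V) (hD0 : 0 ≤ D) {K : ℕ} {s : Position V}
    (hs : BeforeApproach Q β D K s) {F : SimpleGraph V} (hF : s.BreakerLegal b F) :
    ∃ m, (s.afterBreaker F).WalkerLegal m ∧
      (Won P ((s.afterBreaker F).afterWalker m) ∨
        BeforeExposure Q β D K ((s.afterBreaker F).afterWalker m)) := by
  obtain ⟨A, E, hAE, hAW, hQ, hdis, hsum, hX, hK, hloc⟩ := hs
  have hdis' := hF.disjoint hdis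
  have hFβ : (F.edgeSet.ncard : ℝ) ≤ β := le_trans (by exact_mod_cast hF.ncard_le) hb
  have hFdeg : ∀ v, (deg F v : ℝ) ≤ β := fun v =>
    le_trans (by exact_mod_cast deg_le_ncard_edgeSet F v) hFβ
  have hsup : ∀ v, (deg (s.breaker ⊔ F) v : ℝ) ≤ deg s.breaker v + β := fun v => by
    rw [deg_sup_of_disjoint hF.disjoint_breaker]
    push_cast
    have := hFdeg v
    linarith
  by_cases hact : (active E (s.breaker ⊔ F)).Nonempty
  · obtain ⟨v, hv, hmax⟩ := Finset.exists_max_image _ (weight β A (s.breaker ⊔ F)) hact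
    have hsub : active E (s.breaker ⊔ F) ⊆ active E s.breaker := active_anti le_rfl le_sup_left
    -- A single weight is at most the potential. The slack `2 * β` pays for the Breaker moves of
    -- both rounds of the cycle.
    have hBdeg : ∀ x ∈ active E s.breaker, (deg s.breaker x : ℝ) + 2 * β ≤ D := by
      intro x hx
      have h1 : weight β A s.breaker x ≤ Fintype.card V :=
        (Finset.single_le_sum (f := weight β A s.breaker)
          (fun y _ => (weight_pos β A _ y).le) hx).trans hsum
      have := deg_le_of_weight_le hβ h1 (hdeg A E hQ x)
      linarith
    have hBdeg' : ∀ x ∈ active E (s.breaker ⊔ F), (deg (s.breaker ⊔ F) x : ℝ) + β ≤ D := by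
      intro x hx
      have h1 := hBdeg x (hsub hx)
      have h2 := hsup x
      linarith
    obtain ⟨x, hx, hxdeg⟩ : ∃ x, (∀ y, s.location = some y → x = y) ∧
        (deg (s.breaker ⊔ F) x : ℝ) ≤ D + β := by
      rcases hloc with ⟨hl, -, -⟩ | ⟨x, u, hl, -, hx⟩
      -- In her first move Walker may start at the target itself, leaving and returning.
      · refine ⟨v, fun y hy => ?_, ?_⟩
        · rw [hl] at hy; cases hy
        · have := hBdeg' v hv; linarith
      · refine ⟨x, fun y hy => ?_, (hsup x).trans (by linarith)⟩
        rw [hl] at hy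
        exact Option.some.inj hy
    obtain ⟨u, hxu, huv⟩ := exists_two_step_path (s.breaker ⊔ F) x v (by
      have h1 := hBdeg' v hv
      have : ((deg (s.breaker ⊔ F) x + deg (s.breaker ⊔ F) v + 2 : ℕ) : ℝ) < Fintype.card V := by
        push_cast
        linarith
      exact_mod_cast this)
    have hm : (s.afterBreaker F).WalkerLegal ⟨x, u, v⟩ := ⟨hx, hxu, huv⟩
    refine ⟨_, hm, Or.inr ⟨A, E, v, u, hAE, ?_, hQ, hm.disjoint hdis', rfl, hm.adj_last, hv, hmax,
      ?_, hBdeg', ?_, ?_⟩⟩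
    · exact hAW.trans (Position.walker_le_afterWalker (s.afterBreaker F) _)
    · refine (sum_weight_sup_le hβ A hF.disjoint_breaker hFβ _ (weight_pos _ _ _ v).le hmax).trans
        (add_le_add_left ?_ _)
      exact (Finset.sum_le_sum_of_subset_of_nonneg hsub
        fun _ _ _ => (weight_pos _ _ _ _).le).trans hsum
    · intro y
      change (deg ((s.breaker ⊔ F) \ E) y : ℝ) ≤ D
      by_cases hy : y ∈ active E s.breaker
      · have h1 := hBdeg y hy
        have h2 := hsup y
        have h3 : (deg ((s.breaker ⊔ F) \ E) y : ℝ) ≤ deg (s.breaker ⊔ F) y := by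
          exact_mod_cast deg_mono sdiff_le y
        linarith
      · exact le_trans (by exact_mod_cast deg_sdiff_le_of_not_mem_active le_rfl hy) (hX y)
    · refine le_trans (Set.ncard_le_ncard ?_ (Set.toFinite _)) hK
      exact SimpleGraph.edgeSet_subset_edgeSet.2
        (compl_le_compl (sup_le_sup_left le_sup_left _))
  · rw [Finset.not_nonempty_iff_eq_empty] at hact
    -- With no active vertex left, all unexposed pairs belong to Breaker, which is the winning
    -- situation.
    have hEc : Eᶜ ≤ (s.breaker \ E) ⊔ F := by
      intro v w hvw
      have h1 : v ∉ active E (s.breaker ⊔ F) := by simp [hact]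
      rw [mem_active] at h1
      push Not at h1
      have h2 := h1 w
      rw [SimpleGraph.compl_adj] at hvw h2
      simp only [SimpleGraph.sup_adj, SimpleGraph.sdiff_adj] at h2 ⊢
      tauto
    have hEdeg : ∀ v, (deg Eᶜ v : ℝ) ≤ D + β := by
      intro v
      have h1 : (deg Eᶜ v : ℝ) ≤ deg (s.breaker \ E) v + deg F v := by
        exact_mod_cast (deg_mono hEc v).trans (deg_sup_le _ _ v)
      have h2 := hX v
      have h3 := hFdeg v
      linarith
    rcases hloc with ⟨-, rfl, -⟩ | ⟨x, u, hl, hxu, -⟩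
    · exfalso
      have hcard : (0 : ℝ) < Fintype.card V := by linarith
      have hcard' : 0 < Fintype.card V := by exact_mod_cast hcard
      obtain ⟨v⟩ := Fintype.card_pos_iff.1 hcard'
      have h1 := hEdeg v
      rw [compl_bot, deg_top, Nat.cast_sub hcard'] at h1
      push_cast at h1
      linarith
    · have hm : (s.afterBreaker F).WalkerLegal ⟨x, u, x⟩ := Position.walkerLegal_back hl hxu hdis'
      exact ⟨_, hm, Or.inl ⟨hP (hAW.trans (Position.walker_le_afterWalker (s.afterBreaker F) _))
        (hwin A E hAE hQ hEdeg), hm.disjoint hdis', x, u, rfl, hm.adj_last⟩⟩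

theorem BeforeExposure.step (hβ : 0 < β) (hb : (b : ℝ) ≤ β)
    (hsplit : ∀ A E v w, v ≠ w → ¬ E.Adj v w → A ≤ E → Q A E →
      Q A (E ⊔ SimpleGraph.edge v w) ∨ Q (A ⊔ SimpleGraph.edge v w) (E ⊔ SimpleGraph.edge v w))
    {K : ℕ} {s : Position V}
    (hs : BeforeExposure Q β D (K + 1) s) {F : SimpleGraph V} (hF : s.BreakerLegal b F) :
    ∃ m, (s.afterBreaker F).WalkerLegal m ∧
      BeforeApproach Q β D K ((s.afterBreaker F).afterWalker m) := by
  classical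
  obtain ⟨A, E, v, u, hAE, hAW, hQ, hdis, hloc, hvu, hv, hmax, hsum, hdeg, hX, hK⟩ := hs
  have hdis' := hF.disjoint hdis
  have hFβ : (F.edgeSet.ncard : ℝ) ≤ β := le_trans (by exact_mod_cast hF.ncard_le) hb
  have hFdeg : ∀ v, (deg F v : ℝ) ≤ β := fun v =>
    le_trans (by exact_mod_cast deg_le_ncard_edgeSet F v) hFβ
  have hsup : ∀ v, (deg (s.breaker ⊔ F) v : ℝ) ≤ deg s.breaker v + β := fun v => by
    rw [deg_sup_of_disjoint hF.disjoint_breaker]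
    push_cast
    have := hFdeg v
    linarith
  obtain ⟨A', E', hAE', hEE', hQ', hexp⟩ := exists_exposure hsplit (s.breaker ⊔ F) v hAE hQ
  have hanti : (E' ⊔ (s.breaker ⊔ F))ᶜ ≤ (E ⊔ s.breaker)ᶜ :=
    compl_le_compl (sup_le_sup hEE' le_sup_left)
  have hsub : active E' (s.breaker ⊔ F) ⊆ active E s.breaker := active_anti hEE' le_sup_left
  have hAA' : A ≤ A' := by
    rcases hexp with ⟨rfl, -⟩ | ⟨w, -, -, rfl⟩
    · exact le_rfl
    · exact le_sup_left
  -- Walker goes to `u'` and back: along the new edge after a success, along an edge she already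
  -- owns if the exposure was exhausted.
  obtain ⟨u', hvu', hA'⟩ : ∃ u', (s.breaker ⊔ F)ᶜ.Adj v u' ∧
      A' ≤ s.walker ⊔ SimpleGraph.edge v u' := by
    rcases hexp with ⟨rfl, -⟩ | ⟨w, hw, -, rfl⟩
    · exact ⟨u, (le_compl_iff_disjoint_right.2 hdis') hvu, hAW.trans le_sup_left⟩
    · exact ⟨w, (compl_le_compl le_sup_right : _ ≤ (s.breaker ⊔ F)ᶜ) hw, sup_le_sup_right hAW _⟩
  have hm : (s.afterBreaker F).WalkerLegal ⟨v, u', v⟩ := by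
    refine ⟨fun y hy => ?_, hvu', hvu'.symm⟩
    have : some v = some y := hloc.symm.trans hy
    exact Option.some.inj this
  -- With w the weight of `v` before this Breaker move, his two moves add at most w/50 and 1.1w/50,
  -- less than the w/21 that the exposure removes.
  have hpot : ∑ x ∈ active E' (s.breaker ⊔ F), weight β A' (s.breaker ⊔ F) x
      ≤ Fintype.card V := by
    have hexp100 : Real.exp (1 / 100) ≤ 11 / 10 := by
      have h1 : 1 - 1 / 100 ≤ Real.exp (-(1 / 100) : ℝ) := by
        have := Real.add_one_le_exp (-(1 / 100) : ℝ); linarith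
      rw [Real.exp_neg, le_inv_comm₀ (by norm_num) (Real.exp_pos _)] at h1
      exact h1.trans (by norm_num)
    have h1 : ∀ x ∈ active E s.breaker,
        weight β A (s.breaker ⊔ F) x ≤ 11 / 10 * weight β A s.breaker v := by
      intro x hx
      rw [weight_sup A hF.disjoint_breaker, mul_comm]
      refine mul_le_mul (le_trans (Real.exp_le_exp.2 ?_) hexp100) (hmax x hx)
        (weight_pos _ _ _ _).le (by norm_num)
      rw [div_le_iff₀ (by positivity)]
      have := hFdeg x
      linarith
    have hy := weight_pos β A s.breaker v
    have h2 := sum_weight_sup_le hβ A hF.disjoint_breaker hFβ _ (by positivity) h1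
    have h3 : weight β A s.breaker v ≤ weight β A (s.breaker ⊔ F) v :=
      weight_mono hβ A le_sup_left v
    have h4 : ∑ x ∈ active E' (s.breaker ⊔ F), weight β A' (s.breaker ⊔ F) x
        ≤ ∑ x ∈ (active E s.breaker).erase v, weight β A (s.breaker ⊔ F) x
          + 20 / 21 * weight β A (s.breaker ⊔ F) v := by
      have h5 : ∑ x ∈ (active E' (s.breaker ⊔ F)).erase v, weight β A' (s.breaker ⊔ F) x
          ≤ ∑ x ∈ (active E s.breaker).erase v, weight β A (s.breaker ⊔ F) x :=
        (Finset.sum_le_sum fun x _ => weight_anti hAA' _ x).trans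
          (Finset.sum_le_sum_of_subset_of_nonneg (Finset.erase_subset_erase _ hsub)
            fun _ _ _ => (weight_pos _ _ _ _).le)
      by_cases hv' : v ∈ active E' (s.breaker ⊔ F)
      · rw [← Finset.sum_erase_add _ _ hv']
        refine add_le_add h5 ?_
        rcases hexp with ⟨-, hno⟩ | ⟨w, hw, -, rfl⟩
        · obtain ⟨w, hw⟩ := mem_active.1 hv'
          exact absurd hw (hno w)
        · rw [SimpleGraph.compl_adj, SimpleGraph.sup_adj, not_or] at hw
          exact weight_sup_edge_le hAE _ hw.1 hw.2.1
      · rw [Finset.erase_eq_of_notMem hv'] at h5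
        have := weight_pos β A (s.breaker ⊔ F) v
        linarith
    have h6 := Finset.sum_erase_add _ (weight β A (s.breaker ⊔ F)) hv
    linarith
  refine ⟨_, hm, A', E', hAE', ?_, hQ', hm.disjoint hdis', hpot, ?_, ?_,
    Or.inr ⟨v, u', rfl, hm.adj_last, ?_⟩⟩
  · exact hA'.trans (sup_le (Position.walker_le_afterWalker (s.afterBreaker F) _)
      (Position.edge_le_afterWalker (s.afterBreaker F) ⟨v, u', v⟩))
  · intro y
    change (deg ((s.breaker ⊔ F) \ E') y : ℝ) ≤ D
    by_cases hy : y ∈ active E s.breaker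
    · have h1 := hdeg y hy
      have h2 := hsup y
      have h3 : (deg ((s.breaker ⊔ F) \ E') y : ℝ) ≤ deg (s.breaker ⊔ F) y := by
        exact_mod_cast deg_mono sdiff_le y
      linarith
    · exact le_trans (by exact_mod_cast deg_sdiff_le_of_not_mem_active hEE' hy) (hX y)
  -- Since `v` was active, at least one pair there has been settled, so each cycle decreases `K`.
  · obtain ⟨w, hw, hw'⟩ : ∃ w, (E ⊔ s.breaker)ᶜ.Adj v w ∧
        ¬ (E' ⊔ (s.breaker ⊔ F))ᶜ.Adj v w := by
      rcases hexp with ⟨-, hno⟩ | ⟨w, hw, hw', -⟩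
      · obtain ⟨w, hw⟩ := mem_active.1 hv
        exact ⟨w, hw, hno w⟩
      · exact ⟨w, (compl_le_compl (sup_le_sup_left le_sup_left _) : _ ≤ (E ⊔ s.breaker)ᶜ) hw,
          fun h => ((SimpleGraph.compl_adj _ _ _).1 h).2 (Or.inl hw')⟩
    have hlt : (E' ⊔ (s.breaker ⊔ F))ᶜ.edgeSet.ncard < (E ⊔ s.breaker)ᶜ.edgeSet.ncard :=
      Set.ncard_lt_ncard ((Set.ssubset_iff_of_subset
        (SimpleGraph.edgeSet_subset_edgeSet.2 hanti)).2 ⟨s(v, w), hw, hw'⟩) (Set.toFinite _)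
    change (E' ⊔ (s.breaker ⊔ F))ᶜ.edgeSet.ncard ≤ K
    omega
  · change (deg (s.breaker ⊔ F) v : ℝ) ≤ D
    have := hsup v
    have := hdeg v hv
    linarith

/-- Walker wins if she can decide online, edge by edge, which exposed edges belong to a graph of
maximum degree at most `d`, such that she wins with this graph once only few edges at each vertex
have not been exposed. -/
theorem walkerCanCreate_of_online (hP : IsUpperSet P) (hβ : 0 < β) (hb : (b : ℝ) ≤ β)
    (hQ : Q ⊥ ⊥)
    (hsplit : ∀ A E v w, v ≠ w → ¬ E.Adj v w → A ≤ E → Q A E →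
      Q A (E ⊔ SimpleGraph.edge v w) ∨ Q (A ⊔ SimpleGraph.edge v w) (E ⊔ SimpleGraph.edge v w))
    (hdeg : ∀ A E, Q A E → ∀ v, (deg A v : ℝ) ≤ d)
    (hwin : ∀ A E, A ≤ E → Q A E → (∀ v, (deg Eᶜ v : ℝ) ≤ D + β) → A ∈ P)
    (hD : 100 * β * Real.log (Fintype.card V) + 5 * β * d + 2 * β ≤ D)
    (hDV : 2 * (D + β) + 2 < Fintype.card V) (hD0 : 0 ≤ D) :
    WalkerCanCreate b P := by
  have hcard : (0 : ℝ) < Fintype.card V := by linarith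
  have hcard' : 0 < Fintype.card V := by exact_mod_cast hcard
  have : Nonempty V := Fintype.card_pos_iff.1 hcard'
  set N := (⊤ : SimpleGraph V).edgeSet.ncard with hN
  refine walkerCanCreate_of_invariant
    (fun k s => Won P s ∨ (∃ r K, k = 2 * r ∧ K + r = N ∧ BeforeApproach Q β D K s) ∨
      (∃ r K, k = 2 * r + 1 ∧ K + r = N ∧ BeforeExposure Q β D K s)) ?_ ?_ ?_
  · have hdeg0 : ∀ v, deg (⊥ : SimpleGraph V) v = 0 := fun v => by
      have : (⊥ : SimpleGraph V).neighborSet v = ∅ := by ext; simp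
      rw [deg, this, Set.ncard_empty]
    refine Or.inr (Or.inl ⟨0, N, rfl, rfl, ⊥, ⊥, le_rfl, bot_le, hQ, disjoint_bot_left, ?_, ?_, ?_,
      Or.inl ⟨rfl, rfl, rfl⟩⟩)
    · have h1 : ∀ v, weight β (⊥ : SimpleGraph V) ⊥ v = 1 := fun v => by
        simp [weight, hdeg0]
      simp only [Position.initial, h1, Finset.sum_const, nsmul_eq_mul, mul_one]
      exact_mod_cast Finset.card_le_univ _
    · intro v
      simp only [Position.initial, sdiff_self]
      rw [hdeg0]
      simpa using hD0
    · exact Set.ncard_le_ncard (SimpleGraph.edgeSet_subset_edgeSet.2 le_top) (Set.toFinite _)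
  · rintro k s F (hs | ⟨r, K, rfl, hr, hs⟩ | ⟨r, K, rfl, hr, hs⟩) hF
    · obtain ⟨m, hm, h⟩ := hs.step hP hF
      exact ⟨m, hm, Or.inl h⟩
    · obtain ⟨m, hm, h⟩ := hs.step hP hβ hb hdeg hwin hD hDV hD0 hF
      exact ⟨m, hm, h.imp id fun h => Or.inr ⟨r, K, rfl, hr, h⟩⟩
    · cases K with
      | zero =>
        exfalso
        obtain ⟨A, E, v, u, -, -, -, -, -, -, hv, -, -, -, -, hK⟩ := hs
        obtain ⟨w, hw⟩ := mem_active.1 hv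
        rw [Nat.le_zero, Set.ncard_eq_zero (Set.toFinite _)] at hK
        exact Set.notMem_empty s(v, w) (hK ▸ hw)
      | succ K =>
        obtain ⟨m, hm, h⟩ := hs.step hβ hb hsplit hF
        exact ⟨m, hm, Or.inr (Or.inl ⟨r + 1, K, by ring, by omega, h⟩)⟩
  -- Each cycle takes two rounds and uses up one of `N` pairs, so only `Won` is possible by then.
  · refine ⟨2 * (N + 1), ?_⟩
    rintro s (hs | ⟨r, K, h1, h2, -⟩ | ⟨r, K, h1, h2, -⟩)
    · exact hs.1
    · omega
    · omega

end Game

/-! ### Derandomization and choice of constants -/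

section Online

variable {V : Type}

theorem cylinder_split {A E : SimpleGraph V} {v w : V} (hAE : A ≤ E) (hE : ¬ E.Adj v w) :
    cylinder A E = cylinder A (E ⊔ SimpleGraph.edge v w) ∪
      cylinder (A ⊔ SimpleGraph.edge v w) (E ⊔ SimpleGraph.edge v w) := by
  have hdis : Disjoint E (SimpleGraph.edge v w) := by rwa [SimpleGraph.disjoint_edge]
  ext G
  simp only [cylinder, Set.mem_union, Set.mem_ofPred_eq]
  constructor
  · intro h
    rw [inf_sup_left, h]
    by_cases hG : G.Adj v w
    · right
      rw [inf_eq_right.2 ((SimpleGraph.edge_le_iff _).2 (Or.inr hG))]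
    · left
      rw [((SimpleGraph.disjoint_edge _).2 hG).eq_bot, sup_bot_eq]
  · have h0 : G ⊓ E = G ⊓ (E ⊔ SimpleGraph.edge v w) ⊓ E := by
      rw [inf_assoc, inf_eq_right.2 (le_sup_left : E ≤ E ⊔ SimpleGraph.edge v w)]
    rintro (h | h)
    · rw [h0, h, inf_eq_left.2 hAE]
    · rw [h0, h, inf_sup_right, inf_eq_left.2 hAE, inf_comm, hdis.eq_bot, sup_bot_eq]

theorem cylinder_disjoint {A E : SimpleGraph V} {v w : V} (hvw : v ≠ w) (hA : ¬ A.Adj v w) :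
    Disjoint (cylinder A E) (cylinder (A ⊔ SimpleGraph.edge v w) E) := by
  rw [Set.disjoint_left]
  intro G h1 h2
  simp only [cylinder, Set.mem_ofPred_eq] at h1 h2
  refine hA ?_
  rw [← h1, h2]
  exact Or.inr ((SimpleGraph.edge_adj _ _ _ _).2 ⟨Or.inl ⟨rfl, rfl⟩, hvw⟩)

variable [Fintype V]

/-- If the conditional probability of an event exceeds `1/2`, then this remains true for one of the
two outcomes of exposing one more edge. -/
theorem half_lt_split (p : unitInterval) (S : Set (SimpleGraph V)) {A E : SimpleGraph V} {v w : V}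
    (hvw : v ≠ w) (hE : ¬ E.Adj v w) (hAE : A ≤ E)
    (h : (SimpleGraph.binomialRandom V p).real (cylinder A E)
      < 2 * (SimpleGraph.binomialRandom V p).real (cylinder A E ∩ S)) :
    (SimpleGraph.binomialRandom V p).real (cylinder A (E ⊔ SimpleGraph.edge v w))
      < 2 * (SimpleGraph.binomialRandom V p).real
        (cylinder A (E ⊔ SimpleGraph.edge v w) ∩ S) ∨
    (SimpleGraph.binomialRandom V p).real
        (cylinder (A ⊔ SimpleGraph.edge v w) (E ⊔ SimpleGraph.edge v w))
      < 2 * (SimpleGraph.binomialRandom V p).real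
        (cylinder (A ⊔ SimpleGraph.edge v w) (E ⊔ SimpleGraph.edge v w) ∩ S) := by
  by_contra hcon
  push Not at hcon
  rw [cylinder_split hAE hE, Set.union_inter_distrib_right,
    measureReal_union (cylinder_disjoint hvw fun h => hE (hAE h)) (MeasurableSet.of_discrete)] at h
  have := measureReal_union_le (μ := SimpleGraph.binomialRandom V p)
    (cylinder A (E ⊔ SimpleGraph.edge v w) ∩ S)
    (cylinder (A ⊔ SimpleGraph.edge v w) (E ⊔ SimpleGraph.edge v w) ∩ S)
  linarith

/-- If `P` holds robustly with conditional probability more than `1/2` and only few edges at each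
vertex have not been exposed, then the exposed part of the random graph is in `P`. -/
theorem mem_of_half_lt {P : Set (SimpleGraph V)} {ε : ℝ} (hε : 0 < ε) (p : unitInterval)
    (hn : 2 ≤ Fintype.card V)
    (hp : 10 * Real.log (Fintype.card V) ≤ ε * (Fintype.card V * p))
    {S : Set (SimpleGraph V)} (hS : ∀ G ∈ S, RobustlyIn P ε G)
    (hdeg : ∀ G ∈ S, ∀ v, (Fintype.card V * p : ℝ) / 2 ≤ deg G v) {A E : SimpleGraph V}
    (hAE : A ≤ E)
    (h : (SimpleGraph.binomialRandom V p).real (cylinder A E)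
      < 2 * (SimpleGraph.binomialRandom V p).real (cylinder A E ∩ S))
    (hE : ∀ v, (deg Eᶜ v : ℝ) ≤ ε * Fintype.card V / 7) : A ∈ P := by
  classical
  set n : ℝ := (Fintype.card V : ℝ) with hn_def
  set μ := SimpleGraph.binomialRandom V p
  have hn' : (2 : ℝ) ≤ n := by rw [hn_def]; exact_mod_cast hn
  have hp0 : (0 : ℝ) ≤ p := p.2.1
  let T : V → Set (SimpleGraph V) := fun v => {G | ε * (n * p) / 2 < deg (G ⊓ Eᶜ) v}
  have hT : ∀ v, μ.real (cylinder A E ∩ T v) ≤ 1 / (2 * n) * μ.real (cylinder A E) := by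
    intro v
    refine (cylinder_tail p hAE disjoint_compl_left v (z := 2) (by norm_num) (T v)
      (Real.log 2 * (ε * (n * p) / 2)) ?_).trans ?_
    · intro G hG
      rw [← Real.exp_log (show (0 : ℝ) < 2 ^ deg (G ⊓ Eᶜ) v by positivity), Real.log_pow]
      refine Real.exp_le_exp.2 ?_
      rw [mul_comm]
      exact mul_le_mul_of_nonneg_right (le_of_lt hG) (Real.log_nonneg (by norm_num))
    · refine mul_le_mul_of_nonneg_right ?_ measureReal_nonneg
      have h1 : (p : ℝ) * (2 - 1) * deg Eᶜ v ≤ ε * (n * p) / 7 := by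
        have := mul_le_mul_of_nonneg_left (hE v) hp0
        linarith
      have h2 := Real.log_two_gt_d9
      have h3 : 0 ≤ ε * (n * p) := by positivity
      have h4 : (0.6931 : ℝ) * (ε * (n * p) / 2) ≤ Real.log 2 * (ε * (n * p) / 2) :=
        mul_le_mul_of_nonneg_right (by linarith) (by positivity)
      -- Since 1/7 - (log 2)/2 < -1/5, the hypothesis εnp ≥ 10 log n gives a tail of at most n⁻²,
      -- enough for a union bound with total 1/2.
      have h5 : (p : ℝ) * (2 - 1) * deg Eᶜ v - Real.log 2 * (ε * (n * p) / 2)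
          ≤ -(Real.log n + Real.log n) := by
        linarith
      refine (Real.exp_le_exp.2 h5).trans ?_
      rw [Real.exp_neg, Real.exp_add, Real.exp_log (by linarith), one_div]
      exact inv_anti₀ (by positivity) (mul_le_mul_of_nonneg_right hn' (by linarith))
  have hU : μ.real (cylinder A E ∩ ⋃ v, T v) ≤ 1 / 2 * μ.real (cylinder A E) := by
    rw [Set.inter_iUnion]
    refine (measureReal_iUnion_fintype_le _).trans ((Finset.sum_le_sum fun v _ => hT v).trans ?_)
    rw [Finset.sum_const, nsmul_eq_mul, Finset.card_univ, ← hn_def]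
    refine le_of_eq ?_
    field_simp
  obtain ⟨G, ⟨hGc, hGS⟩, hGT⟩ : ∃ G ∈ cylinder A E ∩ S, G ∉ ⋃ v, T v := by
    by_contra hcon
    push Not at hcon
    have : μ.real (cylinder A E ∩ S) ≤ μ.real (cylinder A E ∩ ⋃ v, T v) :=
      measureReal_mono fun G hG => ⟨hG.1, hcon G hG⟩
    linarith
  -- Deleting all unexposed edges of `G` leaves what the cylinder prescribes.
  have hA : G \ (G ⊓ Eᶜ) = A := by
    rw [sdiff_inf_self_left, sdiff_compl]
    exact hGc
  rw [← hA]
  refine hS G hGS _ inf_le_left fun v => ?_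
  have h1 : (deg (G ⊓ Eᶜ) v : ℝ) ≤ ε * (n * p) / 2 :=
    not_lt.1 fun h => hGT (Set.mem_iUnion.2 ⟨v, h⟩)
  have h2 := mul_le_mul_of_nonneg_left (hdeg G hGS v) hε.le
  exact h1.trans (le_trans (le_of_eq (by ring)) h2)

/-- All degrees of the binomial random graph are concentrated. -/
theorem degrees_concentrated (p : unitInterval) (hn : 3 ≤ Fintype.card V)
    (hp : 1000 * Real.log (Fintype.card V) ≤ Fintype.card V * p) :
    (SimpleGraph.binomialRandom V p).real
      {G | ∀ v, (Fintype.card V * p : ℝ) / 2 ≤ deg G v ∧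
        (deg G v : ℝ) ≤ 3 / 2 * (Fintype.card V * p)}ᶜ ≤ 1 / 4 := by
  classical
  set n : ℝ := (Fintype.card V : ℝ) with hn_def
  set μ := SimpleGraph.binomialRandom V p
  have hn' : (3 : ℝ) ≤ n := by rw [hn_def]; exact_mod_cast hn
  have hp0 : (0 : ℝ) ≤ p := p.2.1
  have hp1 : (p : ℝ) ≤ 1 := p.2.2
  have hlog : 1 ≤ Real.log n := by
    rw [Real.le_log_iff_exp_le (by linarith)]
    exact (Real.exp_one_lt_d9.le.trans (by norm_num)).trans hn'
  have hdegtop : ∀ v : V, (deg (⊤ : SimpleGraph V) v : ℝ) = n - 1 := fun v => by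
    rw [deg_top, Nat.cast_sub (by omega), hn_def, Nat.cast_one]
  have hcyl : cylinder (⊥ : SimpleGraph V) ⊥ = Set.univ := by ext; simp [cylinder]
  have htail : ∀ (v : V) (z : ℝ), 0 < z → ∀ (S : Set (SimpleGraph V)) (s : ℝ),
      (∀ G ∈ S, s ≤ deg G v * Real.log z) → p * (z - 1) * (n - 1) - s ≤ -(3 * Real.log n) →
      μ.real S ≤ 1 / (8 * n) := by
    intro v z hz S s hS hs
    have h1 := cylinder_tail p (le_refl (⊥ : SimpleGraph V)) (X := ⊤) disjoint_bot_right v hz S s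
      (fun G hG => by
        rw [inf_top_eq, ← Real.exp_log (show (0 : ℝ) < z ^ deg G v by positivity), Real.log_pow]
        exact Real.exp_le_exp.2 (hS G hG))
    rw [hcyl, Set.univ_inter, probReal_univ, mul_one, hdegtop] at h1
    refine h1.trans ((Real.exp_le_exp.2 hs).trans ?_)
    have h3 : Real.exp (3 * Real.log n) = n ^ 3 := by
      rw [show (3 : ℝ) = ((3 : ℕ) : ℝ) by norm_num, Real.exp_nat_mul, Real.exp_log (by linarith)]
    rw [Real.exp_neg, h3, one_div]
    refine inv_anti₀ (by positivity) ?_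
    nlinarith [mul_nonneg (show 0 ≤ n by linarith) (show 0 ≤ n - 3 by linarith)]
  have h2 := Real.log_two_gt_d9
  have h2' := Real.log_two_lt_d9
  have hnp : 0 ≤ n * p := by positivity
  have hlow : ∀ v, μ.real {G | (deg G v : ℝ) < n * p / 2} ≤ 1 / (8 * n) := by
    intro v
    refine htail v (1 / 2) (by norm_num) _ (-(n * p / 2 * Real.log 2)) ?_ ?_
    · intro G hG
      rw [one_div, Real.log_inv, mul_neg, neg_le_neg_iff]
      exact mul_le_mul_of_nonneg_right (le_of_lt hG) (by linarith)
    · have : n * p / 2 * Real.log 2 ≤ n * p / 2 * 0.6932 :=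
        mul_le_mul_of_nonneg_left (by linarith) (by linarith)
      linarith
  have hup : ∀ v, μ.real {G | 3 / 2 * (n * p) < (deg G v : ℝ)} ≤ 1 / (8 * n) := by
    intro v
    refine htail v 2 (by norm_num) _ (3 / 2 * (n * p) * Real.log 2) ?_ ?_
    · intro G hG
      exact mul_le_mul_of_nonneg_right (le_of_lt hG) (by linarith)
    · have : 3 / 2 * (n * p) * 0.6931 ≤ 3 / 2 * (n * p) * Real.log 2 :=
        mul_le_mul_of_nonneg_left (by linarith) (by linarith)
      linarith
  have hsub : {G : SimpleGraph V | ∀ v, n * p / 2 ≤ deg G v ∧ (deg G v : ℝ) ≤ 3 / 2 * (n * p)}ᶜ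
      ⊆ ⋃ v, ({G | (deg G v : ℝ) < n * p / 2} ∪ {G | 3 / 2 * (n * p) < (deg G v : ℝ)}) := by
    intro G hG
    simp only [Set.mem_compl_iff, Set.mem_ofPred_eq, not_forall, not_and_or, not_le] at hG
    exact Set.mem_iUnion.2 hG
  refine (measureReal_mono hsub).trans ((measureReal_iUnion_fintype_le _).trans
    ((Finset.sum_le_sum fun v _ => (measureReal_union_le _ _).trans
      (add_le_add (hlow v) (hup v))).trans ?_))
  rw [Finset.sum_const, nsmul_eq_mul, Finset.card_univ, ← hn_def]
  refine le_of_eq ?_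
  field_simp
  norm_num

theorem walkerCanCreate_of_robust {P : Set (SimpleGraph V)} (hP : IsUpperSet P) {ε : ℝ}
    (hε₀ : 0 < ε) (hε₁ : ε ≤ 1 / 100) (p : unitInterval) (hn : 3 ≤ Fintype.card V)
    (hp : 10 * Real.log (Fintype.card V) / (ε * Fintype.card V) ≤ p)
    (hrob : 7 / 8 < (SimpleGraph.binomialRandom V p).real {G | RobustlyIn P ε G}) {b : ℕ}
    (hb : (b : ℝ) ≤ ε / (60 * p)) : WalkerCanCreate b P := by
  have hn' : (3 : ℝ) ≤ Fintype.card V := by exact_mod_cast hn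
  set n : ℝ := (Fintype.card V : ℝ) with hn_def
  set μ := SimpleGraph.binomialRandom V p
  have hlog : 1 ≤ Real.log n := by
    rw [Real.le_log_iff_exp_le (by linarith)]
    exact (Real.exp_one_lt_d9.le.trans (by norm_num)).trans hn'
  have hp1 : 10 * Real.log n ≤ ε * (n * p) := by
    rw [div_le_iff₀ (by positivity)] at hp
    linarith
  have hp0 : (0 : ℝ) < p := lt_of_lt_of_le (by positivity) hp
  have hnp : 0 < n * p := by positivity
  have hp2 : 1000 * Real.log n ≤ n * p := by
    have := mul_le_mul_of_nonneg_right hε₁ hnp.le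
    linarith
  -- Scaling by this upper bound instead of `b` keeps the denominator positive even when `b = 0`.
  set β : ℝ := ε / (60 * p) with hβ_def
  have hβ : 0 < β := by positivity
  have hβn : β * (n * p) = ε * n / 60 := by rw [hβ_def]; field_simp
  have hβlog : 1000 * (β * Real.log n) ≤ ε * n / 60 := by
    rw [← hβn]
    have := mul_le_mul_of_nonneg_left hp2 hβ.le
    linarith
  have hβ1 : β ≤ β * Real.log n := le_mul_of_one_le_right hβ.le hlog
  have hεn : 0 < ε * n := by positivity
  have hεn' : ε * n ≤ 1 / 100 * n := mul_le_mul_of_nonneg_right hε₁ (by linarith)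
  set Dg : Set (SimpleGraph V) := {G | ∀ v, n * p / 2 ≤ deg G v ∧
    (deg G v : ℝ) ≤ 3 / 2 * (n * p)} with hDg
  set S : Set (SimpleGraph V) := {G | RobustlyIn P ε G} ∩ Dg with hS_def
  have hS : 1 < 2 * μ.real S := by
    have h1 : μ.real Dgᶜ ≤ 1 / 4 := degrees_concentrated p hn hp2
    have h2 : μ.real {G | RobustlyIn P ε G} ≤ μ.real (S ∪ Dgᶜ) := by
      refine measureReal_mono fun G hG => ?_
      by_cases h : G ∈ Dg
      · exact Or.inl ⟨hG, h⟩
      · exact Or.inr h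
    have h3 := measureReal_union_le (μ := μ) S Dgᶜ
    linarith
  -- As βnp = εn/60, the main term 5βd equals εn/8; the gap to εn/7 absorbs 100β log n ≤ εn/600 and
  -- the remaining multiples of β.
  refine walkerCanCreate_of_online (β := β) (d := 3 / 2 * (n * p)) (D := ε * n / 7 - β)
    (Q := fun A E => μ.real (cylinder A E) < 2 * μ.real (cylinder A E ∩ S))
    hP hβ hb ?_ ?_ ?_ ?_ ?_ ?_ ?_
  · have hcyl : cylinder (⊥ : SimpleGraph V) ⊥ = Set.univ := by ext; simp [cylinder]
    simpa only [hcyl, Set.univ_inter, probReal_univ] using hS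
  · intro A E v w hvw hE hAE h
    exact half_lt_split p S hvw hE hAE h
  · intro A E h v
    obtain ⟨G, hG, hGS⟩ : (cylinder A E ∩ S).Nonempty := by
      rw [Set.nonempty_iff_ne_empty]
      intro h0
      simp only [h0, measureReal_empty, mul_zero] at h
      exact absurd h (not_lt.2 measureReal_nonneg)
    have hAG : A ≤ G := by
      have : G ⊓ E = A := hG
      exact this ▸ inf_le_left
    exact le_trans (by exact_mod_cast deg_mono hAG v) (hGS.2 v).2
  · intro A E hAE h hE
    refine mem_of_half_lt hε₀ p (by omega) hp1 (fun G hG => hG.1) (fun G hG v => (hG.2 v).1) hAE h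
      fun v => ?_
    have := hE v
    linarith
  · rw [← hn_def]
    linarith
  · rw [← hn_def]
    linarith
  · linarith

end Online

end WalkerBreaker

theorem mainTheorem3 (ε : ℝ) (hε₀ : 0 < ε) (hε₁ : ε ≤ 1 / 100)
    (p : ℕ → unitInterval)
    (P : ∀ n : ℕ, Set (SimpleGraph (Fin n)))
    (hmono : ∀ n, IsUpperSet (P n))
    (hres : WalkerBreaker.IsResilient P p ε) :
    ∀ᶠ n : ℕ in Filter.atTop,
      10 * Real.log (n : ℝ) / (ε * (n : ℝ)) ≤ (p n : ℝ) → (p n : ℝ) < 1 →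
        ∀ b : ℕ, (b : ℝ) ≤ ε / (60 * (p n : ℝ)) →
          WalkerBreaker.WalkerCanCreate b (P n) := by
  have h1 : Tendsto (fun n : ℕ => (SimpleGraph.binomialRandom (Fin n) (p n)).real
      {G : SimpleGraph (Fin n) | WalkerBreaker.RobustlyIn (P n) ε G}) atTop (𝓝 1) := by
    rw [← ENNReal.toReal_one]
    exact (ENNReal.tendsto_toReal ENNReal.one_ne_top).comp hres
  -- Losing 1/4 to irregular degrees leaves 5/8, still above 1/2.
  filter_upwards [h1.eventually (lt_mem_nhds (show (7 / 8 : ℝ) < 1 by norm_num)),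
    eventually_ge_atTop 3] with n hrob hn hp _ b hb
  exact WalkerBreaker.walkerCanCreate_of_robust (hmono n) hε₀ hε₁ (p n) (by simpa using hn)
    (by simpa using hp) hrob hb
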